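/- Let $A$ be a $C^*$-algebra (not necessarily unital) and $E$ a Hilbert $C^*$-module over $A$. Write $L(E)$ for the bounded adjointable operators on $E$, and, for Hilbert $A$-modules $F, F'$, write $K(F,F')$ for the compact operators $F\to F'$, i.e. the operator-norm closure of the linear span of the elementary operators $\theta_{u,v}(z)=u\langle v,z\rangle$ ($u\in F'$, $v\in F$); put $K(E)=K(E,E)$. An ($A$-linear) closed densely defined operator $t:D(t)\subseteq E\to E$ with densely defined adjoint $t^*$ is called *regular* if $1+t^*t$ has dense range, and *selfadjoint* if moreover $t=t^*$. A regular operator $t$ is called *Fredholm* if there are $G,G'\in L(E)$ such that $Gt$ and $tG'$ (on their natural domains) are closable, with closures belonging to $L(E)$ and equal to $1$ modulo $K(E)$. For regular $t$, let $E(t)$ be the domain $D(t)$ with the $A$-valued inner product $\langle x,y\rangle_t=\langle x,y\rangle+\langle t x,t y\rangle$; an operator $s$ with $D(t)\subseteq D(s)$ is called *$t$-compact* if $s|_{D(t)}:E(t)\to E$ belongs to $K(E(t),E)$. The graph of a regular operator $t$ is orthogonally complemented in $E\oplus E$; let $P_{G(t)}$ be the orthogonal projection onto it. The *gap metric* on regular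 operators is $g(t,s)=\|P_{G(t)}-P_{G(s)}\|$. **Theorem.** Let $t$ be a selfadjoint regular Fredholm operator on $E$, let $\Lambda$ be a topological space (for instance an interval), and let $\lambda\mapsto A_\lambda$ be a norm-continuous map from $\Lambda$ to the bounded operators on $E$ such that every $A_\lambda$ is selfadjoint (adjointable with $A_\lambda^*=A_\lambda$) and $t$-compact. Then, for every $\lambda\in\Lambda$, the operator $t+A_\lambda$ with domain $D(t)$ is a selfadjoint regular Fredholm operator, and $\lambda\mapsto t+A_\lambda$ is continuous with respect to the gap metric. -/

import Mathlib

namespace HilbertCStar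

section Basics

set_option linter.unusedSectionVars false

variable (A : Type*) {E F : Type*} [NonUnitalCStarAlgebra A] [PartialOrder A] [StarOrderedRing A]
  [NormedAddCommGroup E] [NormedSpace ℂ E] [SMul A E] [CStarModule A E]
  [NormedAddCommGroup F] [NormedSpace ℂ F] [SMul A F] [CStarModule A F]

/-- Vectors of a Hilbert C⋆-module are separated by their inner products. -/
theorem ext_inner {x y : E} (h : ∀ z : E, inner A z x = inner A z y) : x = y := by
  have h0 : inner A (x - y) (x - y) = 0 := by
    rw [CStarModule.inner_sub_right, h, sub_self]
  exact sub_eq_zero.mp (CStarModule.inner_self.mp h0)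

theorem norm_op_smul_le (a : A) (x : E) : ‖a • x‖ ≤ ‖a‖ * ‖x‖ := by
  refine abs_le_of_sq_le_sq' ?_ (by positivity) |>.2
  rw [mul_pow, CStarModule.norm_sq_eq A (x := a • x), CStarModule.norm_sq_eq A (x := x),
    CStarModule.inner_op_smul_right, CStarModule.inner_op_smul_left]
  calc ‖a * (inner A x x * star a)‖ ≤ ‖a‖ * (‖(inner A x x : A)‖ * ‖star a‖) :=
        (norm_mul_le _ _).trans (mul_le_mul_of_nonneg_left (norm_mul_le _ _) (norm_nonneg _))
    _ = ‖a‖ ^ 2 * ‖(inner A x x : A)‖ := by rw [norm_star]; ring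

/-- The elementary operator `θ_{u,v} : F → E`, `θ_{u,v} z = ⟨v, z⟩ • u`. -/
noncomputable def rankOne (u : E) (v : F) : F →L[ℂ] E :=
  LinearMap.mkContinuous
    { toFun := fun z => (inner A v z : A) • u
      map_add' := fun z w => by
        apply ext_inner A
        intro y
        simp [add_mul]
      map_smul' := fun c z => by
        apply ext_inner A
        intro y
        simp [smul_mul_assoc] }
    (‖v‖ * ‖u‖)
    (fun z => by
      refine (norm_op_smul_le A _ u).trans ?_
      calc ‖(inner A v z : A)‖ * ‖u‖ ≤ (‖v‖ * ‖z‖) * ‖u‖ :=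
            mul_le_mul_of_nonneg_right (CStarModule.norm_inner_le F) (norm_nonneg _)
        _ = ‖v‖ * ‖u‖ * ‖z‖ := by ring)

theorem rankOne_apply (u : E) (v z : F) : rankOne A u v z = (inner A v z : A) • u := rfl

/-- The bounded operator `T` belongs to `K(F, E)`: it is a norm limit of finite linear
combinations of elementary operators. -/
def IsCompactOp (T : F →L[ℂ] E) : Prop :=
  T ∈ closure
    (Submodule.span ℂ {S : F →L[ℂ] E | ∃ (u : E) (v : F), S = rankOne A u v} : Set (F →L[ℂ] E))

/-- The bounded operator `T` belongs to `L(F, E)`, that is, it has an adjoint. -/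
def IsAdjointable (T : F →L[ℂ] E) : Prop :=
  ∃ S : E →L[ℂ] F, ∀ (x : F) (y : E), (inner A (T x) y : A) = inner A x (S y)

/-- The bounded operator `T` is adjointable with `T = T⋆`. -/
def IsSelfAdjointBdd (T : E →L[ℂ] E) : Prop :=
  ∀ x y : E, (inner A (T x) y : A) = inner A x (T y)

end Basics

section Unbounded

variable (A : Type*) {E : Type*} [NonUnitalCStarAlgebra A] [PartialOrder A] [StarOrderedRing A]
  [NormedAddCommGroup E] [NormedSpace ℂ E] [SMul A E] [CStarModule A E]

/-- A bounded operator, viewed as an operator with domain all of `E`. -/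
def toOp (T : E →L[ℂ] E) : E →ₗ.[ℂ] E := (T : E →ₗ[ℂ] E).toPMap ⊤

/-- The composition `s t` of partially defined operators, on its natural domain
`{x ∈ D(t) | t x ∈ D(s)}`. -/
def pcomp (s t : E →ₗ.[ℂ] E) : E →ₗ.[ℂ] E :=
  s.comp (t.domRestrict ((s.domain.comap t.toFun).map t.domain.subtype)) (by
    rintro ⟨x, hx, hxt⟩
    obtain ⟨y, hy, rfl⟩ := hx
    have h : (t.domRestrict ((s.domain.comap t.toFun).map t.domain.subtype)) ⟨_, ⟨y, hy, rfl⟩, hxt⟩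
        = t y := LinearPMap.domRestrict_apply rfl
    rw [h]
    exact hy)

/-- The operator `t` is `A`-linear and its domain is an `A`-submodule. -/
class IsModuleOp (t : E →ₗ.[ℂ] E) : Prop where
  smul_mem : ∀ (a : A) (x : t.domain), a • (x : E) ∈ t.domain
  map_smul : ∀ (a : A) (x : t.domain), t ⟨a • (x : E), smul_mem a x⟩ = a • t x

/-- The graph of the adjoint: the pairs `(y, z)` with `⟨t x, y⟩ = ⟨x, z⟩` for all `x ∈ D(t)`. -/
def adjointGraph (t : E →ₗ.[ℂ] E) : Submodule ℂ (E × E) where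
  carrier := {p | ∀ x : t.domain, (inner A (t x) p.1 : A) = inner A (x : E) p.2}
  add_mem' := fun {p q} hp hq x => by
    simp only [Prod.fst_add, Prod.snd_add, CStarModule.inner_add_right]
    rw [hp x, hq x]
  zero_mem' := fun x => by simp
  smul_mem' := fun c p hp x => by
    simp only [Prod.smul_fst, Prod.smul_snd, CStarModule.inner_smul_right_complex]
    rw [hp x]

/-- The adjoint `t⋆` of an operator; it is meant for densely defined `t`, for which
`adjointGraph` is the graph of an operator. -/
noncomputable def adjoint (t : E →ₗ.[ℂ] E) : E →ₗ.[ℂ] E := (adjointGraph A t).toLinearPMap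

/-- Regular operators: closed, densely defined, with densely defined adjoint, and such that
`1 + t⋆ t` has dense range. -/
structure IsRegular (t : E →ₗ.[ℂ] E) : Prop where
  isModuleOp : IsModuleOp A t
  isClosed : t.IsClosed
  dense_domain : Dense (t.domain : Set E)
  dense_adjoint_domain : Dense ((adjoint A t).domain : Set E)
  dense_range : Dense (Set.range (toOp (ContinuousLinearMap.id ℂ E) + pcomp (adjoint A t) t))

/-- Selfadjoint regular operators. -/
structure IsSelfAdjointRegular (t : E →ₗ.[ℂ] E) : Prop where
  isRegular : IsRegular A t
  adjoint_eq : adjoint A t = t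

/-- The operator `s` is closable and its closure is a bounded adjointable operator on `E` which
is the identity modulo compact operators. -/
def ClosureIsOneModCompact (s : E →ₗ.[ℂ] E) : Prop :=
  s.IsClosable ∧ ∃ T : E →L[ℂ] E,
    s.closure = toOp T ∧ IsAdjointable A T ∧ IsCompactOp A (T - ContinuousLinearMap.id ℂ E)

/-- Fredholm operators: there are a pseudo left inverse and a pseudo right inverse in `L(E)`.
The notion is meant for regular `t`. -/
def IsFredholm (t : E →ₗ.[ℂ] E) : Prop :=
  (∃ G : E →L[ℂ] E, IsAdjointable A G ∧ ClosureIsOneModCompact A (pcomp (toOp G) t)) ∧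
    ∃ G : E →L[ℂ] E, IsAdjointable A G ∧ ClosureIsOneModCompact A (pcomp t (toOp G))

end Unbounded

section GraphModule

variable (A : Type*) {E : Type*} [NonUnitalCStarAlgebra A] [PartialOrder A] [StarOrderedRing A]
  [NormedAddCommGroup E] [NormedSpace ℂ E] [SMul A E] [CStarModule A E]

/-- The Hilbert C⋆-module `E(t)`: the domain of `t`, to be equipped with the `A`-valued inner
product `⟨x, y⟩ + ⟨t x, t y⟩` and the norm coming from it. -/
@[nolint unusedArguments]
def GraphModule (_A : Type*) (t : E →ₗ.[ℂ] E) : Type _ := t.domain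

variable (t : E →ₗ.[ℂ] E)

namespace GraphModule

variable {A t}

/-- An element of `E(t)` as an element of the domain of `t`. -/
def toDomain (x : GraphModule A t) : t.domain := x

end GraphModule

noncomputable instance : AddCommGroup (GraphModule A t) := inferInstanceAs (AddCommGroup t.domain)

noncomputable instance : Module ℂ (GraphModule A t) := inferInstanceAs (Module ℂ t.domain)

instance [IsModuleOp A t] : SMul A (GraphModule A t) where
  smul a x := ⟨a • (x.toDomain : E), IsModuleOp.smul_mem a x.toDomain⟩

noncomputable instance : Norm (GraphModule A t) where
  norm x := √‖(inner A (x.toDomain : E) (x.toDomain : E) : A)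
    + inner A (t x.toDomain) (t x.toDomain)‖

noncomputable instance [IsModuleOp A t] : CStarModule A (GraphModule A t) where
  inner x y := inner A (x.toDomain : E) (y.toDomain : E) + inner A (t x.toDomain) (t y.toDomain)
  inner_add_right {x y z} := by
    have h1 : ((y + z).toDomain : E) = y.toDomain + z.toDomain := rfl
    have h2 : t (y + z).toDomain = t y.toDomain + t z.toDomain := t.map_add _ _
    rw [h1, h2, CStarModule.inner_add_right, CStarModule.inner_add_right]
    abel
  inner_self_nonneg := add_nonneg CStarModule.inner_self_nonneg CStarModule.inner_self_nonneg
  inner_self {x} := by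
    refine ⟨fun h => ?_, fun h => ?_⟩
    · have h1 : (inner A (x.toDomain : E) (x.toDomain : E) : A) ≤ 0 :=
        (le_add_of_nonneg_right CStarModule.inner_self_nonneg).trans_eq h
      have h2 : (x.toDomain : E) = 0 :=
        CStarModule.inner_self.mp (le_antisymm h1 (CStarModule.inner_self_nonneg (A := A)))
      exact Subtype.ext h2
    · have h1 : (x.toDomain : E) = 0 := by rw [h]; rfl
      have h2 : t x.toDomain = 0 := by rw [h]; exact t.map_zero
      rw [h1, h2]
      simp
  inner_op_smul_right {a x y} := by
    have h1 : ((a • y).toDomain : E) = a • (y.toDomain : E) := rfl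
    have h2 : t (a • y).toDomain = a • t y.toDomain := IsModuleOp.map_smul a y.toDomain
    rw [h1, h2, CStarModule.inner_op_smul_right, CStarModule.inner_op_smul_right, mul_add]
  inner_smul_right_complex {z x y} := by
    have h1 : ((z • y).toDomain : E) = z • (y.toDomain : E) := rfl
    have h2 : t (z • y).toDomain = z • t y.toDomain := t.map_smul _ _
    rw [h1, h2, CStarModule.inner_smul_right_complex, CStarModule.inner_smul_right_complex,
      smul_add]
  star_inner x y := by simp
  norm_eq_sqrt_norm_inner_self x := rfl

noncomputable instance [IsModuleOp A t] : NormedAddCommGroup (GraphModule A t) :=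
  CStarModule.normedAddCommGroup A

noncomputable instance [IsModuleOp A t] : NormedSpace ℂ (GraphModule A t) :=
  .ofCore (CStarModule.normedSpaceCore A)

/-- The operator `s` is relatively `t`-compact: `D(t) ⊆ D(s)` and `s : E(t) → E` is a compact
operator between Hilbert C⋆-modules. -/
def IsRelCompact (s t : E →ₗ.[ℂ] E) : Prop :=
  ∃ (_ : IsModuleOp A t) (h : t.domain ≤ s.domain) (T : GraphModule A t →L[ℂ] E),
    (∀ x : GraphModule A t, T x = s ⟨x.toDomain, h x.toDomain.2⟩) ∧ IsCompactOp A T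

end GraphModule

section Gap

open scoped WithCStarModule

variable (A : Type*) {E : Type*} [NonUnitalCStarAlgebra A] [PartialOrder A] [StarOrderedRing A]
  [NormedAddCommGroup E] [NormedSpace ℂ E] [SMul A E] [CStarModule A E]

/-- `P` is the orthogonal projection of the Hilbert C⋆-module `E ⊕ E` onto the graph of `t`. -/
structure IsGraphProj (t : E →ₗ.[ℂ] E) (P : C⋆ᵐᵒᵈ(A, E × E) →L[ℂ] C⋆ᵐᵒᵈ(A, E × E)) : Prop where
  idem : P ∘L P = P
  selfAdjoint : IsSelfAdjointBdd A P
  range_eq : Set.range P = {z | WithCStarModule.equiv A (E × E) z ∈ t.graph}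

/-- There is at most one orthogonal projection onto the graph of `t`. -/
theorem IsGraphProj.unique {t : E →ₗ.[ℂ] E} {P Q : C⋆ᵐᵒᵈ(A, E × E) →L[ℂ] C⋆ᵐᵒᵈ(A, E × E)}
    (hP : IsGraphProj A t P) (hQ : IsGraphProj A t Q) : P = Q := by
  have fixP : ∀ z, z ∈ Set.range P → P z = z := by
    rintro _ ⟨w, rfl⟩
    exact DFunLike.congr_fun hP.idem w
  have fixQ : ∀ z, z ∈ Set.range Q → Q z = z := by
    rintro _ ⟨w, rfl⟩
    exact DFunLike.congr_fun hQ.idem w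
  have hr : Set.range P = Set.range Q := hP.range_eq.trans hQ.range_eq.symm
  ext1 z
  have h1 : P (Q z) = Q z := fixP _ (hr ▸ ⟨z, rfl⟩)
  have h2 : ∀ w, Q (P w) = P w := fun w => fixQ _ (hr ▸ ⟨w, rfl⟩)
  rw [← h1]
  apply ext_inner A
  intro w
  rw [← hP.selfAdjoint, ← hP.selfAdjoint, ← hQ.selfAdjoint, h2]

open Classical in
/-- The orthogonal projection onto the graph of `t` (with the value `0` if there is none). -/
noncomputable def graphProj (t : E →ₗ.[ℂ] E) : C⋆ᵐᵒᵈ(A, E × E) →L[ℂ] C⋆ᵐᵒᵈ(A, E × E) :=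
  if h : ∃ P, IsGraphProj A t P then h.choose else 0

/-- The gap metric, meant for operators with orthogonally complemented graph. -/
noncomputable def gap (t s : E →ₗ.[ℂ] E) : ℝ := ‖graphProj A t - graphProj A s‖

/-- The family `l ↦ s l` is continuous in the gap metric; it is part of the notion that the
graphs are orthogonally complemented, so that the gap metric is defined on them. -/
def GapContinuous {Λ : Type*} [TopologicalSpace Λ] (s : Λ → (E →ₗ.[ℂ] E)) : Prop :=
  (∀ l, IsGraphProj A (s l) (graphProj A (s l))) ∧
    ∀ l₀, Filter.Tendsto (fun l => gap A (s l) (s l₀)) (nhds l₀) (nhds 0)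

end Gap

end HilbertCStar

/-! Everything rests on the identity `⟨(t + c)x, (t + c)y⟩ = ⟨x, y⟩ + ⟨t x, t y⟩` for symmetric `t`
and `c = ±i` (`IsSymmOp.inner_shift`). It bounds `t + c` below by `1`, so a surjective `t + c` has
an inverse `R` of norm at most `1`, whatever the symmetric `t`.

For selfadjoint regular `t` the range of `t ± i` is closed by this bound and dense because it
contains the range of `1 + t²`. As the bound on the inverse is the same for every symmetric
operator, surjectivity passes from `t` to `t + B` in finitely many Neumann steps. Then `1 + (t + B)²
= (t + B + i)(t + B - i)` is surjective, which gives regularity (`IsSelfAdjointRegular.add_toOp`).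

The resolvent is an isometry `E → E(t)` with adjoint `t + c`, so relative compactness of `B` makes
`B R` compact. If `G` is a left parametrix of `t`, then `G` and `G⋆` are left and right parametrices
of `t + B`: the error terms change by `G B` and `B G⋆`, and `B G⋆ = B R (t + i) G⋆` is compact
(`IsFredholm.add_toOp`).

The graph projection is `W W⋆` with `W x = (R x, x - i R x)`, and the second resolvent identity
makes `R` Lipschitz in `B`; hence the gap continuity. -/

namespace HilbertCStar

/-! ### Calculus of graphs, adjoints and symmetry -/

section Graphs

variable {A : Type*} {E : Type*} [NonUnitalCStarAlgebra A] [PartialOrder A] [StarOrderedRing A]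
  [NormedAddCommGroup E] [NormedSpace ℂ E] [SMul A E] [CStarModule A E]

theorem mem_graph_toOp {T : E →L[ℂ] E} {x y : E} : (x, y) ∈ (toOp T).graph ↔ T x = y := by
  rw [LinearPMap.mem_graph_iff]
  constructor
  · rintro ⟨⟨x', hx'⟩, h1, h2⟩
    subst h1
    exact h2
  · intro h
    exact ⟨⟨x, trivial⟩, rfl, h⟩

theorem mem_graph_add {s t : E →ₗ.[ℂ] E} {x y : E} :
    (x, y) ∈ (s + t).graph ↔ ∃ u v, (x, u) ∈ s.graph ∧ (x, v) ∈ t.graph ∧ u + v = y := by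
  constructor
  · intro h
    obtain ⟨⟨x', hs, ht⟩, h1, h2⟩ := (LinearPMap.mem_graph_iff _).1 h
    subst h1
    exact ⟨s ⟨x', hs⟩, t ⟨x', ht⟩, s.mem_graph ⟨x', hs⟩, t.mem_graph ⟨x', ht⟩, h2⟩
  · rintro ⟨u, v, hu, hv, rfl⟩
    obtain ⟨⟨x1, hs⟩, h1, h2⟩ := (LinearPMap.mem_graph_iff _).1 hu
    obtain ⟨⟨x2, ht⟩, h3, h4⟩ := (LinearPMap.mem_graph_iff _).1 hv
    simp only at h1 h2 h3 h4
    subst h1 h2 h3 h4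
    exact (LinearPMap.mem_graph_iff _).2 ⟨⟨x2, hs, ht⟩, rfl, rfl⟩

/-- The graph of `t + B` is a sheared copy of the graph of `t`; in this form questions about `t + B`
reduce to `t` without handling domains. -/
theorem mem_graph_add_toOp {t : E →ₗ.[ℂ] E} {B : E →L[ℂ] E} {x y : E} :
    (x, y) ∈ (t + toOp B).graph ↔ (x, y - B x) ∈ t.graph := by
  rw [mem_graph_add]
  constructor
  · rintro ⟨u, v, hu, hv, rfl⟩
    rw [mem_graph_toOp.1 hv, add_sub_cancel_right]
    exact hu
  · intro h
    exact ⟨_, B x, h, mem_graph_toOp.2 rfl, sub_add_cancel _ _⟩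

theorem add_toOp_domain (t : E →ₗ.[ℂ] E) (B : E →L[ℂ] E) : (t + toOp B).domain = t.domain :=
  inf_top_eq _

theorem mem_graph_pcomp {s t : E →ₗ.[ℂ] E} {x z : E} :
    (x, z) ∈ (pcomp s t).graph ↔ ∃ y, (x, y) ∈ t.graph ∧ (y, z) ∈ s.graph := by
  have key : ∀ (x : E) (h : x ∈ (pcomp s t).domain) (h1 : x ∈ t.domain)
      (h2 : t ⟨x, h1⟩ ∈ s.domain), pcomp s t ⟨x, h⟩ = s ⟨t ⟨x, h1⟩, h2⟩ := fun x h h1 h2 => rfl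
  constructor
  · intro h
    obtain ⟨⟨x', hx'⟩, h1, h2⟩ := (LinearPMap.mem_graph_iff _).1 h
    simp only at h1 h2
    subst h1 h2
    obtain ⟨⟨w, hw, hwx⟩, hxt⟩ := id hx'
    have hwx' : (w : E) = x' := hwx
    subst hwx'
    have hw' : t w ∈ s.domain := hw
    refine ⟨t w, t.mem_graph w, ?_⟩
    rw [key _ hx' w.2 hw']
    exact s.mem_graph ⟨t w, hw'⟩
  · rintro ⟨y, hy, hz⟩
    obtain ⟨w, h1, h2⟩ := (LinearPMap.mem_graph_iff _).1 hy
    obtain ⟨v, h3, h4⟩ := (LinearPMap.mem_graph_iff _).1 hz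
    simp only at h1 h2 h3 h4
    subst h1 h2 h4
    have hv : t w ∈ s.domain := h3 ▸ v.2
    have hd : (w : E) ∈ (pcomp s t).domain := ⟨⟨w, hv, rfl⟩, w.2⟩
    refine (LinearPMap.mem_graph_iff _).2 ⟨⟨w, hd⟩, rfl, ?_⟩
    rw [key _ hd w.2 hv]
    congr 1
    exact Subtype.ext h3.symm

theorem isClosed_toOp (T : E →L[ℂ] E) : (toOp T).IsClosed := by
  have : ((toOp T).graph : Set (E × E)) = {p | T p.1 = p.2} := by
    ext ⟨x, y⟩
    exact mem_graph_toOp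
  rw [LinearPMap.IsClosed, this]
  exact isClosed_eq (by fun_prop) (by fun_prop)

/-- A densely defined restriction of a bounded operator has that operator as its closure. -/
theorem closure_eq_toOp {s : E →ₗ.[ℂ] E} {T : E →L[ℂ] E} (hd : Dense (s.domain : Set E))
    (hs : s ≤ toOp T) : s.IsClosable ∧ s.closure = toOp T := by
  have hc : s.IsClosable := (isClosed_toOp T).isClosable.leIsClosable hs
  refine ⟨hc, LinearPMap.eq_of_eq_graph ?_⟩
  rw [← hc.graph_closure_eq_closure_graph]
  refine le_antisymm ?_ ?_
  · exact Submodule.topologicalClosure_minimal _ (LinearPMap.le_graph_of_le hs) (isClosed_toOp T)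
  · rintro ⟨x, y⟩ h
    obtain rfl := mem_graph_toOp.1 h
    have hf : Continuous fun x : E => (x, T x) := by fun_prop
    refine map_mem_closure (f := fun x : E => (x, T x)) hf (hd x) fun z hz => ?_
    have h1 := s.mem_graph ⟨z, hz⟩
    have h2 := mem_graph_toOp.1 (LinearPMap.le_graph_of_le hs h1)
    simp only at h2
    change (z, T z) ∈ s.graph
    rwa [h2]

/-- If `(0, y)` lies in `adjointGraph`, then `y` is orthogonal to the dense domain, hence to all of
`E` by continuity, so `y = 0`. -/
theorem graph_adjoint {t : E →ₗ.[ℂ] E} (hd : Dense (t.domain : Set E)) :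
    (adjoint A t).graph = adjointGraph A t := by
  refine Submodule.toLinearPMap_graph_eq _ ?_
  rintro ⟨x, y⟩ h rfl
  have h0 : ∀ z : t.domain, (inner A (z : E) y : A) = 0 := fun z => by
    simpa using (h z).symm
  have hcl : IsClosed {z : E | (inner A z y : A) = 0} := by
    have : {z : E | (inner A z y : A) = 0} = {z : E | (inner A y z : A) = 0} := by
      ext z
      simp only [Set.mem_ofPred_eq]
      rw [← CStarModule.star_inner (A := A) z y, star_eq_zero]
    rw [this]
    refine isClosed_eq ?_ continuous_const
    have : Continuous fun z => CStarModule.innerSL (A := A) y z := (CStarModule.innerSL y).continuous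
    exact this
  have h1 : (Set.univ : Set E) ⊆ {z : E | (inner A z y : A) = 0} := by
    rw [← hd.closure_eq]
    exact hcl.closure_subset_iff.2 fun z hz => h0 ⟨z, hz⟩
  exact CStarModule.inner_self.1 (h1 (Set.mem_univ y))

theorem IsSelfAdjointRegular.mem_graph_iff {t : E →ₗ.[ℂ] E} (ht : IsSelfAdjointRegular A t)
    {p : E × E} : p ∈ t.graph ↔ ∀ q ∈ t.graph, (inner A q.2 p.1 : A) = inner A q.1 p.2 := by
  conv_lhs => rw [← ht.adjoint_eq, graph_adjoint ht.isRegular.dense_domain]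
  constructor
  · rintro h ⟨x, y⟩ hq
    obtain ⟨w, h1, h2⟩ := (LinearPMap.mem_graph_iff _).1 hq
    simp only at h1 h2
    subst h1 h2
    exact h w
  · intro h x
    exact h _ (t.mem_graph x)

/-- Symmetry of an operator, in terms of its graph. -/
def IsSymmOp (A : Type*) {E : Type*} [NonUnitalCStarAlgebra A] [PartialOrder A]
    [StarOrderedRing A] [NormedAddCommGroup E] [NormedSpace ℂ E] [SMul A E] [CStarModule A E]
    (t : E →ₗ.[ℂ] E) : Prop :=
  ∀ p ∈ t.graph, ∀ q ∈ t.graph, (inner A p.2 q.1 : A) = inner A p.1 q.2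

theorem IsSelfAdjointRegular.isSymmOp {t : E →ₗ.[ℂ] E} (ht : IsSelfAdjointRegular A t) :
    IsSymmOp A t := fun p hp _ hq => ht.mem_graph_iff.1 hq p hp

theorem IsSymmOp.add_toOp {t : E →ₗ.[ℂ] E} (ht : IsSymmOp A t) {B : E →L[ℂ] E}
    (hB : IsSelfAdjointBdd A B) : IsSymmOp A (t + toOp B) := by
  rintro ⟨x, y⟩ hp ⟨x', y'⟩ hq
  have h := ht _ (mem_graph_add_toOp.1 hp) _ (mem_graph_add_toOp.1 hq)
  simp only [CStarModule.inner_sub_left, CStarModule.inner_sub_right, hB x x'] at h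
  exact sub_left_injective h

end Graphs

/-! ### Resolvents at `±i`; selfadjointness and regularity of the perturbation -/

section Resolvent

variable {A : Type*} {E : Type*} [NonUnitalCStarAlgebra A] [PartialOrder A] [StarOrderedRing A]
  [NormedAddCommGroup E] [NormedSpace ℂ E] [SMul A E] [CStarModule A E]

/-- The scalars `±i`. -/
structure IsImagUnit (c : ℂ) : Prop where
  star_eq : star c = -c
  mul_self : c * c = -1

theorem isImagUnit_I : IsImagUnit Complex.I := ⟨by simp, by simp⟩

theorem IsImagUnit.neg {c : ℂ} (hc : IsImagUnit c) : IsImagUnit (-c) :=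
  ⟨by rw [star_neg, hc.star_eq], by rw [neg_mul_neg, hc.mul_self]⟩

/-- Since `star c = -c`, the two cross terms cancel by symmetry, and `star c * c = 1`. -/
theorem IsSymmOp.inner_shift {t : E →ₗ.[ℂ] E} (ht : IsSymmOp A t) {c : ℂ} (hc : IsImagUnit c)
    {p q : E × E} (hp : p ∈ t.graph) (hq : q ∈ t.graph) :
    (inner A (p.2 + c • p.1) (q.2 + c • q.1) : A) = inner A p.1 q.1 + inner A p.2 q.2 := by
  simp only [CStarModule.inner_add_left, CStarModule.inner_add_right,
    CStarModule.inner_smul_left_complex, CStarModule.inner_smul_right_complex, hc.star_eq,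
    ht p hp q hq, smul_add, smul_smul, mul_neg, hc.mul_self]
  module

/-- Both `⟨p.1, p.1⟩` and `⟨p.2, p.2⟩` are positive and lie below `⟨p.2 + c p.1, p.2 + c p.1⟩`; the
norm of `E × E` is the maximum of the two norms. -/
theorem IsSymmOp.norm_le_shift {t : E →ₗ.[ℂ] E} (ht : IsSymmOp A t) {c : ℂ} (hc : IsImagUnit c)
    {p : E × E} (hp : p ∈ t.graph) : ‖p‖ ≤ ‖p.2 + c • p.1‖ := by
  have key : ∀ a b : A, 0 ≤ a → 0 ≤ b → ‖a‖ ≤ ‖a + b‖ := fun a b ha hb =>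
    CStarAlgebra.norm_le_norm_of_nonneg_of_le ha (le_add_of_nonneg_right hb)
  refine max_le ?_ ?_ <;> refine le_of_sq_le_sq ?_ (norm_nonneg _) <;>
    rw [CStarModule.norm_sq_eq A, CStarModule.norm_sq_eq A, ht.inner_shift hc hp hp]
  · exact key _ _ CStarModule.inner_self_nonneg CStarModule.inner_self_nonneg
  · rw [add_comm]
    exact key _ _ CStarModule.inner_self_nonneg CStarModule.inner_self_nonneg

/-- The operator `t + c` is surjective. -/
def ShiftSurjective (t : E →ₗ.[ℂ] E) (c : ℂ) : Prop :=
  ∀ y, ∃ p ∈ t.graph, p.2 + c • p.1 = y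

/-- The bounded operator `R` is the inverse of `t + c`. -/
structure IsResolvent (t : E →ₗ.[ℂ] E) (c : ℂ) (R : E →L[ℂ] E) : Prop where
  mem_graph : ∀ y, (R y, y - c • R y) ∈ t.graph
  apply_shift : ∀ p ∈ t.graph, R (p.2 + c • p.1) = p.1
  norm_le : ‖R‖ ≤ 1

theorem IsSymmOp.exists_isResolvent {t : E →ₗ.[ℂ] E} (ht : IsSymmOp A t) {c : ℂ}
    (hc : IsImagUnit c) (hs : ShiftSurjective t c) : ∃ R, IsResolvent t c R := by
  choose f hf hfy using hs
  -- The lower bound makes `t + c` injective, so the chosen preimages depend linearly on `y`.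
  have huniq : ∀ p ∈ t.graph, ∀ q ∈ t.graph, p.2 + c • p.1 = q.2 + c • q.1 → p = q := by
    intro p hp q hq h
    have h1 := ht.norm_le_shift hc (t.graph.sub_mem hp hq)
    have h2 : (p - q).2 + c • (p - q).1 = 0 := by
      simp only [Prod.fst_sub, Prod.snd_sub]
      rw [← sub_eq_zero.2 h]
      module
    rw [h2, norm_zero] at h1
    exact sub_eq_zero.1 (norm_le_zero_iff.1 h1)
  let R : E →L[ℂ] E := LinearMap.mkContinuous
    { toFun := fun y => (f y).1
      map_add' := fun x y => by
        rw [huniq _ (hf (x + y)) _ (t.graph.add_mem (hf x) (hf y)), Prod.fst_add]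
        rw [hfy, Prod.fst_add, Prod.snd_add]
        nth_rw 1 [← hfy x, ← hfy y]
        module
      map_smul' := fun a y => by
        rw [huniq _ (hf (a • y)) _ (t.graph.smul_mem a (hf y))]
        · rfl
        · rw [hfy, Prod.smul_fst, Prod.smul_snd]
          nth_rw 1 [← hfy y]
          module } 1
    (fun y => by
      rw [one_mul]
      have h1 := ht.norm_le_shift hc (hf y)
      rw [hfy] at h1
      exact (norm_fst_le _).trans h1)
  have hR : ∀ y, R y = (f y).1 := fun y => rfl
  refine ⟨R, ⟨fun y => ?_, fun p hp => ?_, ?_⟩⟩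
  · have : (R y, y - c • R y) = f y := by
      refine Prod.ext (hR y) ?_
      rw [hR]
      exact sub_eq_of_eq_add (hfy y).symm
    rw [this]
    exact hf y
  · rw [hR, huniq _ (hf _) p hp (hfy _)]
  · exact LinearMap.mkContinuous_norm_le _ zero_le_one _

theorem IsSelfAdjointBdd.map_op_smul {B : E →L[ℂ] E} (hB : IsSelfAdjointBdd A B) (a : A) (x : E) :
    B (a • x) = a • B x := by
  apply ext_inner A
  intro z
  rw [← hB, CStarModule.inner_op_smul_right, CStarModule.inner_op_smul_right, hB]

variable [CompleteSpace E]

/-- Factor `t + C + c = (1 + C R)(t + c)` with `R` the inverse of `t + c`; as `‖C R‖ < 1`, the first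
factor is invertible by the Neumann series. -/
theorem ShiftSurjective.add_toOp_of_norm_lt_one {t : E →ₗ.[ℂ] E} (ht : IsSymmOp A t) {c : ℂ}
    (hc : IsImagUnit c) (hs : ShiftSurjective t c) {C : E →L[ℂ] E} (hC : ‖C‖ < 1) :
    ShiftSurjective (t + toOp C) c := by
  obtain ⟨R, hR⟩ := ht.exists_isResolvent hc hs
  have hn : ‖-(C * R)‖ < 1 := by
    rw [norm_neg]
    refine (norm_mul_le _ _).trans_lt ?_
    exact (mul_le_of_le_one_right (norm_nonneg _) hR.norm_le).trans_lt hC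
  obtain ⟨u, hu⟩ := isUnit_one_sub_of_norm_lt_one hn
  intro y
  set w := (↑u⁻¹ : E →L[ℂ] E) y with hw
  have h1 : w + C (R w) = y := by
    have h2 : (↑u * ↑u⁻¹ : E →L[ℂ] E) y = y := by rw [Units.mul_inv]; rfl
    have h3 : (u : E →L[ℂ] E) w = y := h2
    rw [hu] at h3
    simpa using h3
  refine ⟨(R w, w - c • R w + C (R w)), mem_graph_add_toOp.2 ?_, ?_⟩
  · simpa using hR.mem_graph w
  · simp only
    rw [← h1]
    module

/-- Split `B` into `n` equal summands of norm below `1` and add them one at a time. Every `t + k C`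
is symmetric, so the resolvent bound stays `1` and the admissible step does not shrink. -/
theorem ShiftSurjective.add_toOp {t : E →ₗ.[ℂ] E} (ht : IsSymmOp A t) {c : ℂ}
    (hc : IsImagUnit c) (hs : ShiftSurjective t c) {B : E →L[ℂ] E} (hB : IsSelfAdjointBdd A B) :
    ShiftSurjective (t + toOp B) c := by
  obtain ⟨n, hn⟩ := exists_nat_gt ‖B‖
  have hn0 : (0 : ℝ) < n := (norm_nonneg _).trans_lt hn
  set C : E →L[ℂ] E := ((n : ℝ)⁻¹) • B with hCdef
  have hC : ‖C‖ < 1 := by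
    rw [hCdef, norm_smul, norm_inv, Real.norm_natCast, inv_mul_lt_iff₀ hn0, mul_one]
    exact hn
  have hCsa : IsSelfAdjointBdd A C := fun x y => by
    simp only [hCdef, smul_apply, CStarModule.inner_smul_left_real,
      CStarModule.inner_smul_right_real, hB x y]
  have hkC : ∀ k : ℕ, IsSelfAdjointBdd A (k • C) := fun k x y => by
    simp only [← Nat.cast_smul_eq_nsmul ℝ, smul_apply,
      CStarModule.inner_smul_left_real, CStarModule.inner_smul_right_real, hCsa x y]
  have key : ∀ k : ℕ, ShiftSurjective (t + toOp (k • C)) c := by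
    intro k
    induction k with
    | zero =>
      intro y
      obtain ⟨p, hp, hpy⟩ := hs y
      exact ⟨p, mem_graph_add_toOp.2 (by simpa using hp), hpy⟩
    | succ k ih =>
      intro y
      obtain ⟨p, hp, hpy⟩ := ih.add_toOp_of_norm_lt_one (ht.add_toOp (hkC k)) hc hC y
      refine ⟨p, mem_graph_add_toOp.2 ?_, hpy⟩
      have h := mem_graph_add_toOp.1 (mem_graph_add_toOp.1 hp)
      convert h using 2
      rw [add_smul, one_smul, add_apply]
      abel
  have hnC : n • C = B := by
    rw [← Nat.cast_smul_eq_nsmul ℝ, hCdef, smul_inv_smul₀ hn0.ne']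
  exact hnC ▸ key n

theorem IsSelfAdjointRegular.shiftSurjective {t : E →ₗ.[ℂ] E} (ht : IsSelfAdjointRegular A t)
    {c : ℂ} (hc : IsImagUnit c) : ShiftSurjective t c := by
  let f : t.graph →ₗ[ℂ] E :=
    (LinearMap.snd ℂ E E + c • LinearMap.fst ℂ E E).domRestrict t.graph
  have hf : ∀ p : t.graph, f p = (p : E × E).2 + c • (p : E × E).1 := fun p => rfl
  have hcomplete : CompleteSpace t.graph :=
    (show IsClosed (t.graph : Set (E × E)) from ht.isRegular.isClosed).completeSpace_coe
  have hanti : AntilipschitzWith 1 f := AddMonoidHomClass.antilipschitz_of_bound f fun p => by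
    rw [NNReal.coe_one, one_mul, hf]
    exact ht.isSymmOp.norm_le_shift hc p.2
  have hcont : UniformContinuous f := by
    have : Continuous fun p : t.graph => (p : E × E).2 + c • (p : E × E).1 := by fun_prop
    exact uniformContinuous_of_continuousAt_zero f this.continuousAt
  have hclosed : IsClosed (Set.range f) := hanti.isClosed_range hcont
  have hdense : Dense (Set.range f) := by
    refine ht.isRegular.dense_range.mono ?_
    rintro _ ⟨x, rfl⟩
    have hx := LinearPMap.mem_graph _ x
    obtain ⟨u, v, hu, hv, huv⟩ := mem_graph_add.1 hx
    obtain ⟨z, hz, hzv⟩ := mem_graph_pcomp.1 hv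
    rw [ht.adjoint_eq] at hzv
    have hu' := mem_graph_toOp.1 hu
    -- The graph point over `(t - c)x`, where `z = t x` and `v = t z`: applying `t + c` gives `t² x
    -- - c² x = x + t² x`.
    refine ⟨⟨(z, v) - c • ((x : E), z), t.graph.sub_mem hzv (t.graph.smul_mem c hz)⟩, ?_⟩
    rw [hf, ← huv, ← hu']
    simp only [Prod.fst_sub, Prod.snd_sub, Prod.smul_fst, Prod.smul_snd, smul_sub, smul_smul,
      hc.mul_self, ContinuousLinearMap.id_apply]
    module
  intro y
  have hy : y ∈ Set.range f := by
    rw [← hclosed.closure_eq]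
    exact hdense y
  obtain ⟨p, hp⟩ := hy
  exact ⟨p, p.2, hp⟩

/-- A bounded selfadjoint perturbation of a selfadjoint regular operator is selfadjoint and
regular. -/
theorem IsSelfAdjointRegular.add_toOp {t : E →ₗ.[ℂ] E} (ht : IsSelfAdjointRegular A t)
    {B : E →L[ℂ] E} (hB : IsSelfAdjointBdd A B) : IsSelfAdjointRegular A (t + toOp B) := by
  have hdense : Dense ((t + toOp B).domain : Set E) := by
    rw [add_toOp_domain]
    exact ht.isRegular.dense_domain
  have hadj : adjoint A (t + toOp B) = t + toOp B := by
    refine LinearPMap.eq_of_eq_graph ?_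
    rw [graph_adjoint hdense]
    ext ⟨x, y⟩
    rw [mem_graph_add_toOp, ht.mem_graph_iff]
    constructor
    -- The contributions of `B` on the two sides of the pairing agree because `B` is selfadjoint, so
    -- they cancel.
    · rintro h ⟨u, v⟩ hq
      have hq' : (u, v + B u) ∈ (t + toOp B).graph := mem_graph_add_toOp.2 (by simpa using hq)
      obtain ⟨w, h1, h2⟩ := (LinearPMap.mem_graph_iff _).1 hq'
      have h3 := h w
      simp only at h1 h2 h3
      rw [h1, h2, CStarModule.inner_add_left, hB] at h3
      rw [CStarModule.inner_sub_right, ← h3, add_sub_cancel_right]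
    · intro h w
      have h3 := h _ (mem_graph_add_toOp.1 ((t + toOp B).mem_graph w))
      simp only [CStarModule.inner_sub_left, CStarModule.inner_sub_right, hB (w : E) x] at h3
      exact sub_left_injective h3
  refine ⟨⟨?_, ?_, hdense, ?_, ?_⟩, hadj⟩
  · have key : ∀ (a : A) (x : (t + toOp B).domain),
        (a • (x : E), a • (t + toOp B) x) ∈ (t + toOp B).graph := by
      intro a x
      obtain ⟨w, h1, h2⟩ := (LinearPMap.mem_graph_iff _).1
        (mem_graph_add_toOp.1 ((t + toOp B).mem_graph x))
      have hm := ht.isRegular.isModuleOp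
      refine mem_graph_add_toOp.2 ?_
      have h3 : (a • (w : E), a • t w) ∈ t.graph := by
        rw [← hm.map_smul]
        exact t.mem_graph ⟨a • (w : E), hm.smul_mem a w⟩
      rw [h1, h2] at h3
      convert h3 using 2
      simp only at h1 h2 ⊢
      apply ext_inner A
      intro z
      simp only [CStarModule.inner_sub_right, CStarModule.inner_op_smul_right,
        hB.map_op_smul a, mul_sub]
    exact
      { smul_mem := fun a x => LinearPMap.mem_domain_of_mem_graph (key a x)
        map_smul := fun a x => by
          exact LinearPMap.mem_graph_snd_inj _ (LinearPMap.mem_graph _ _) (key a x) rfl }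
  · have h : ((t + toOp B).graph : Set (E × E)) =
        (fun p : E × E => (p.1, p.2 - B p.1)) ⁻¹' (t.graph : Set (E × E)) := by
      ext ⟨x, y⟩
      exact mem_graph_add_toOp
    rw [LinearPMap.IsClosed, h]
    exact IsClosed.preimage (by fun_prop) ht.isRegular.isClosed
  · rw [hadj]
    exact hdense
  · rw [hadj]
    have h1 := (ht.shiftSurjective isImagUnit_I).add_toOp ht.isSymmOp isImagUnit_I hB
    have h2 := (ht.shiftSurjective isImagUnit_I.neg).add_toOp ht.isSymmOp isImagUnit_I.neg hB
    have hr : Set.range (toOp (ContinuousLinearMap.id ℂ E) + pcomp (t + toOp B) (t + toOp B)) =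
        Set.univ := by
      refine Set.eq_univ_of_forall fun y => ?_
      -- With `s = t + B`, solve `(s + i)u = y` and then `(s - i)x = u`; this `x` satisfies `x + s²
      -- x = y`.
      obtain ⟨⟨u, v⟩, hp, hpy⟩ := h1 y
      obtain ⟨⟨x, z⟩, hq, hqu⟩ := h2 u
      simp only at hpy hqu
      have hz : z = u + Complex.I • x := by rw [← hqu]; module
      have hzz : (z, v + Complex.I • z) ∈ (t + toOp B).graph := by
        have h := (t + toOp B).graph.add_mem hp ((t + toOp B).graph.smul_mem Complex.I hq)
        rw [hz]
        simpa [hz] using h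
      refine LinearPMap.mem_range_iff.2 ⟨x, mem_graph_add.2 ⟨x, v + Complex.I • z,
        mem_graph_toOp.2 rfl, mem_graph_pcomp.2 ⟨z, hq, hzz⟩, ?_⟩⟩
      rw [← hpy, hz, smul_add, smul_smul, Complex.I_mul_I]
      module
    rw [hr]
    exact dense_univ

end Resolvent

/-! ### Adjoint pairs and compact operators -/

section Compact

variable {A : Type*} {E F F' : Type*} [NonUnitalCStarAlgebra A] [PartialOrder A]
  [StarOrderedRing A]
  [NormedAddCommGroup E] [NormedSpace ℂ E] [SMul A E] [CStarModule A E]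
  [NormedAddCommGroup F] [NormedSpace ℂ F] [SMul A F] [CStarModule A F]
  [NormedAddCommGroup F'] [NormedSpace ℂ F'] [SMul A F'] [CStarModule A F']

/-- The bounded operators `T` and `S` are adjoint to each other. -/
def IsAdjPair (A : Type*) {E F : Type*} [NonUnitalCStarAlgebra A] [PartialOrder A]
    [StarOrderedRing A]
    [NormedAddCommGroup E] [NormedSpace ℂ E] [SMul A E] [CStarModule A E]
    [NormedAddCommGroup F] [NormedSpace ℂ F] [SMul A F] [CStarModule A F]
    (T : F →L[ℂ] E) (S : E →L[ℂ] F) : Prop :=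
  ∀ x y, (inner A (T x) y : A) = inner A x (S y)

theorem IsAdjPair.symm {T : F →L[ℂ] E} {S : E →L[ℂ] F} (h : IsAdjPair A T S) :
    IsAdjPair A S T := fun x y => by
  rw [← CStarModule.star_inner (A := A) y (S x), ← h, CStarModule.star_inner]

theorem IsAdjPair.sub {T T' : F →L[ℂ] E} {S S' : E →L[ℂ] F} (h : IsAdjPair A T S)
    (h' : IsAdjPair A T' S') : IsAdjPair A (T - T') (S - S') := fun x y => by
  simp only [sub_apply, CStarModule.inner_sub_left, CStarModule.inner_sub_right, h x y, h' x y]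

theorem IsAdjPair.add {T T' : F →L[ℂ] E} {S S' : E →L[ℂ] F} (h : IsAdjPair A T S)
    (h' : IsAdjPair A T' S') : IsAdjPair A (T + T') (S + S') := fun x y => by
  simp only [add_apply, CStarModule.inner_add_left, CStarModule.inner_add_right, h x y, h' x y]

theorem IsAdjPair.smul {T : F →L[ℂ] E} {S : E →L[ℂ] F} (h : IsAdjPair A T S) (c : ℂ) :
    IsAdjPair A (c • T) (star c • S) := fun x y => by
  simp only [smul_apply, CStarModule.inner_smul_left_complex,
    CStarModule.inner_smul_right_complex, h x y]

theorem IsAdjPair.comp {T : F →L[ℂ] E} {S : E →L[ℂ] F} {T' : F' →L[ℂ] F} {S' : F →L[ℂ] F'}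
    (h : IsAdjPair A T S) (h' : IsAdjPair A T' S') : IsAdjPair A (T ∘L T') (S' ∘L S) :=
  fun x y => by simp only [ContinuousLinearMap.comp_apply, h (T' x) y, h' x (S y)]

theorem isAdjPair_id : IsAdjPair A (ContinuousLinearMap.id ℂ E) (ContinuousLinearMap.id ℂ E) :=
  fun _ _ => rfl

/-- From `‖S y‖² = ‖⟨T S y, y⟩‖` and Cauchy–Schwarz. It lets norm approximations pass to adjoints.
-/
theorem IsAdjPair.norm_le {T : F →L[ℂ] E} {S : E →L[ℂ] F} (h : IsAdjPair A T S) : ‖S‖ ≤ ‖T‖ := by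
  refine ContinuousLinearMap.opNorm_le_bound _ (norm_nonneg _) fun y => ?_
  rcases (norm_nonneg (S y)).eq_or_lt with h0 | h0
  · rw [← h0]
    positivity
  · refine le_of_mul_le_mul_right ?_ h0
    calc ‖S y‖ * ‖S y‖ = ‖(inner A (T (S y)) y : A)‖ := by
          rw [h, ← CStarModule.norm_sq_eq A, sq]
      _ ≤ ‖T (S y)‖ * ‖y‖ := CStarModule.norm_inner_le E
      _ ≤ (‖T‖ * ‖S y‖) * ‖y‖ := by gcongr; exact T.le_opNorm _
      _ = ‖T‖ * ‖y‖ * ‖S y‖ := by ring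

theorem isAdjPair_rankOne (u : E) (v : F) : IsAdjPair A (rankOne A u v) (rankOne A v u) :=
  fun x y => by
    rw [rankOne_apply, rankOne_apply, CStarModule.inner_op_smul_left,
      CStarModule.inner_op_smul_right, CStarModule.star_inner]

theorem IsCompactOp.add {T S : F →L[ℂ] E} (hT : IsCompactOp A T) (hS : IsCompactOp A S) :
    IsCompactOp A (T + S) :=
  (Submodule.topologicalClosure _).add_mem hT hS

/-- `θ_{u,v} R = θ_{u,R'v}`, and composing with `R` on the right is continuous. Only the values of
`R'` enter, so a bare function suffices; this is convenient for `t + c` on `E(t)`. -/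
theorem IsCompactOp.comp {T : F →L[ℂ] E} (hT : IsCompactOp A T) {R : F' →L[ℂ] F} {R' : F → F'}
    (hR : ∀ x y, (inner A (R x) y : A) = inner A x (R' y)) : IsCompactOp A (T ∘L R) := by
  let Φ : (F →L[ℂ] E) →L[ℂ] (F' →L[ℂ] E) := (ContinuousLinearMap.compL ℂ F' F E).flip R
  refine map_mem_closure (f := Φ) Φ.continuous hT fun S hS => ?_
  refine Submodule.span_induction (p := fun S _ => Φ S ∈ Submodule.span ℂ _)
    ?_ ?_ ?_ ?_ hS
  · rintro _ ⟨u, v, rfl⟩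
    refine Submodule.subset_span ⟨u, R' v, ?_⟩
    ext1 z
    change rankOne A u v (R z) = _
    rw [rankOne_apply, rankOne_apply, ← CStarModule.star_inner (A := A) (R z) v, hR,
      CStarModule.star_inner]
  · rw [map_zero]
    exact Submodule.zero_mem _
  · intro x y _ _ hx hy
    rw [map_add]
    exact Submodule.add_mem _ hx hy
  · intro a x _ hx
    rw [map_smul]
    exact Submodule.smul_mem _ a hx

/-- Adjoints of compact operators are compact. -/
theorem IsCompactOp.adjoint {T : F →L[ℂ] E} {S : E →L[ℂ] F} (hT : IsCompactOp A T)
    (h : IsAdjPair A T S) : IsCompactOp A S := by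
  have key : ∀ V ∈ Submodule.span ℂ {S : F →L[ℂ] E | ∃ (u : E) (v : F), S = rankOne A u v},
      ∃ W ∈ Submodule.span ℂ {S : E →L[ℂ] F | ∃ (u : F) (v : E), S = rankOne A u v},
        IsAdjPair A V W := by
    intro V hV
    induction hV using Submodule.span_induction with
    | mem x hx =>
      obtain ⟨u, v, rfl⟩ := hx
      exact ⟨_, Submodule.subset_span ⟨v, u, rfl⟩, isAdjPair_rankOne u v⟩
    | zero => exact ⟨0, Submodule.zero_mem _, fun x y => by simp⟩
    | add x y _ _ hx hy =>
      obtain ⟨W, hW, h1⟩ := hx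
      obtain ⟨W', hW', h2⟩ := hy
      exact ⟨_, Submodule.add_mem _ hW hW', h1.add h2⟩
    | smul a x _ hx =>
      obtain ⟨W, hW, h1⟩ := hx
      exact ⟨_, Submodule.smul_mem _ (star a) hW, h1.smul a⟩
  refine Metric.mem_closure_iff.2 fun ε hε => ?_
  obtain ⟨V, hV, hVT⟩ := Metric.mem_closure_iff.1 hT ε hε
  obtain ⟨W, hW, hVW⟩ := key V hV
  refine ⟨W, hW, ?_⟩
  rw [dist_eq_norm] at hVT ⊢
  exact (h.sub hVW).norm_le.trans_lt hVT

end Compact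

/-! ### Parametrices of the perturbed operator -/

section Fredholm

variable {A : Type*} {E : Type*} [NonUnitalCStarAlgebra A] [PartialOrder A] [StarOrderedRing A]
  [NormedAddCommGroup E] [NormedSpace ℂ E] [SMul A E] [CStarModule A E]

/-- Symmetry of `t` at the graph points over `R x` and `R' y`; the terms in `⟨R x, R' y⟩` cancel
since `star c = -c`. -/
theorem IsResolvent.isAdjPair {t : E →ₗ.[ℂ] E} (ht : IsSymmOp A t) {c : ℂ} (hc : IsImagUnit c)
    {R R' : E →L[ℂ] E} (hR : IsResolvent t c R) (hR' : IsResolvent t (-c) R') :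
    IsAdjPair A R R' := by
  intro x y
  have h := ht _ (hR.mem_graph x) _ (hR'.mem_graph y)
  simp only [CStarModule.inner_sub_left, CStarModule.inner_sub_right,
    CStarModule.inner_smul_left_complex, CStarModule.inner_smul_right_complex, hc.star_eq] at h
  exact (sub_left_injective h).symm

/-- The composition of a relatively compact operator with the resolvent is compact. -/
theorem IsRelCompact.comp_resolvent {t : E →ₗ.[ℂ] E} (ht : IsSymmOp A t) {c : ℂ}
    (hc : IsImagUnit c) {R B : E →L[ℂ] E} (hR : IsResolvent t c R)
    (hB : IsRelCompact A (toOp B) t) : IsCompactOp A (B ∘L R) := by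
  obtain ⟨hm, hD, T, hT, hTc⟩ := hB
  have hmem : ∀ y, R y ∈ t.domain := fun y => LinearPMap.mem_domain_of_mem_graph (hR.mem_graph y)
  have hval : ∀ y, t ⟨R y, hmem y⟩ = y - c • R y := fun y =>
    LinearPMap.mem_graph_snd_inj _ (t.mem_graph ⟨R y, hmem y⟩) (hR.mem_graph y) rfl
  let J₀ : E →ₗ[ℂ] GraphModule A t :=
    LinearMap.codRestrict t.domain (R : E →ₗ[ℂ] E) hmem
  -- The resolvent, seen as a map into `E(t)`, has `t + c` as its adjoint; this is `inner_shift`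
  -- read with the graph inner product.
  have hinner : ∀ (x : E) (v : GraphModule A t),
      (inner A (J₀ x) v : A) = inner A x (t v.toDomain + c • (v.toDomain : E)) := by
    intro x v
    have h1 : (inner A (J₀ x) v : A) =
        inner A (R x) (v.toDomain : E) + inner A (t ⟨R x, hmem x⟩) (t v.toDomain) := rfl
    have h2 := ht.inner_shift hc (hR.mem_graph x) (t.mem_graph v.toDomain)
    simp only [sub_add_cancel] at h2
    rw [h1, h2, hval]
  have hbound : ∀ x, ‖J₀ x‖ ≤ 1 * ‖x‖ := by
    intro x
    rw [one_mul, CStarModule.norm_eq_sqrt_norm_inner_self (A := A) (J₀ x),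
      CStarModule.norm_eq_sqrt_norm_inner_self (A := A) x, hinner]
    have h3 : t (J₀ x).toDomain + c • ((J₀ x).toDomain : E) = x := by
      change t ⟨R x, hmem x⟩ + c • R x = x
      rw [hval, sub_add_cancel]
    rw [h3]
  let J : E →L[ℂ] GraphModule A t := J₀.mkContinuous 1 hbound
  have hBR : B ∘L R = T ∘L J := by
    ext1 x
    exact (hT (J x)).symm
  rw [hBR]
  exact hTc.comp (R' := fun v => t v.toDomain + c • (v.toDomain : E)) hinner

variable [CompleteSpace E]

/-- Relatively compact bounded selfadjoint perturbations preserve the Fredholm property. -/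
theorem IsFredholm.add_toOp {t : E →ₗ.[ℂ] E} (htF : IsFredholm A t)
    (ht : IsSelfAdjointRegular A t) {B : E →L[ℂ] E} (hB : IsSelfAdjointBdd A B)
    (hBc : IsRelCompact A (toOp B) t) : IsFredholm A (t + toOp B) := by
  obtain ⟨R, hR⟩ := ht.isSymmOp.exists_isResolvent isImagUnit_I (ht.shiftSurjective isImagUnit_I)
  obtain ⟨R', hR'⟩ := ht.isSymmOp.exists_isResolvent isImagUnit_I.neg
    (ht.shiftSurjective isImagUnit_I.neg)
  have hcpt : IsCompactOp A (B ∘L R) := hBc.comp_resolvent ht.isSymmOp isImagUnit_I hR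
  obtain ⟨⟨G, ⟨G', hG⟩, -, T, hT, ⟨T', hTT⟩, hTc⟩, -⟩ := htF
  replace hG : IsAdjPair A G G' := hG
  replace hTT : IsAdjPair A T T' := hTT
  have hGT : ∀ p ∈ t.graph, T p.1 = G p.2 := by
    rintro ⟨x, y⟩ hp
    have h1 : (x, G y) ∈ (pcomp (toOp G) t).graph :=
      -- `G t` is a restriction of its closure `T`.
      mem_graph_pcomp.2 ⟨y, hp, mem_graph_toOp.2 rfl⟩
    have h2 := LinearPMap.le_graph_of_le (LinearPMap.le_closure _) h1
    rw [hT] at h2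
    exact mem_graph_toOp.1 h2
  -- Dualizing `G t ⊆ T` with `t = t⋆` gives `t G' = T'` on all of `E`: the adjoint of a left
  -- parametrix is a right parametrix.
  have hgraph : ∀ y, (G' y, T' y) ∈ t.graph := fun y => by
    rw [ht.mem_graph_iff]
    intro q hq
    rw [← hG q.2 y, ← hGT q hq, hTT]
  -- `R (t + i) G' = G'` and `t G' = T'`; this exhibits `B G'` as the compact `B R` times an
  -- adjointable operator.
  have hBG : B ∘L G' = (B ∘L R) ∘L (T' + Complex.I • G') := by
    ext1 y
    have h := hR.apply_shift _ (hgraph y)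
    simp only at h
    change B (G' y) = B (R (T' y + Complex.I • G' y))
    rw [h]
  -- The closures of `(t + B) G'` and `G (t + B)` are adjoint to each other, so compactness of one
  -- error term gives the other.
  have hadj : IsAdjPair A (T' + B ∘L G') (T + G ∘L B) :=
    hTT.symm.add (IsAdjPair.comp (show IsAdjPair A B B from hB) hG.symm)
  have hcpt2 : IsCompactOp A (T' + B ∘L G' - ContinuousLinearMap.id ℂ E) := by
    have h1 : IsCompactOp A (T' - ContinuousLinearMap.id ℂ E) :=
      hTc.adjoint (hTT.sub isAdjPair_id)
    have h2 : IsCompactOp A (B ∘L G') := by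
      rw [hBG]
      exact hcpt.comp (hTT.symm.add (hG.symm.smul Complex.I))
    rw [add_sub_right_comm]
    exact h1.add h2
  refine ⟨⟨G, ⟨G', hG⟩, ?_⟩, ⟨G', ⟨G, hG.symm⟩, ?_⟩⟩
  · have hle : pcomp (toOp G) (t + toOp B) ≤ toOp (T + G ∘L B) := by
      refine LinearPMap.le_of_le_graph ?_
      rintro ⟨x, z⟩ h
      obtain ⟨y, hy, hz⟩ := mem_graph_pcomp.1 h
      rw [mem_graph_toOp] at hz ⊢
      have h1 := hGT _ (mem_graph_add_toOp.1 hy)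
      simp only at h1
      rw [add_apply, h1, ContinuousLinearMap.comp_apply, map_sub, sub_add_cancel, hz]
    have hdense : Dense ((pcomp (toOp G) (t + toOp B)).domain : Set E) := by
      refine ht.isRegular.dense_domain.mono fun x hx => ?_
      have hx' : x ∈ (t + toOp B).domain := by rwa [add_toOp_domain]
      exact LinearPMap.mem_domain_of_mem_graph
        (mem_graph_pcomp.2 ⟨_, (t + toOp B).mem_graph ⟨x, hx'⟩, mem_graph_toOp.2 rfl⟩)
    obtain ⟨h1, h2⟩ := closure_eq_toOp hdense hle
    exact ⟨h1, _, h2, ⟨_, hadj.symm⟩, hcpt2.adjoint (hadj.sub isAdjPair_id)⟩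
  -- Here the composition is defined on all of `E`, because `G'` maps into the domain of `t`.
  · have hmem : ∀ y, (y, (T' + B ∘L G') y) ∈ (pcomp (t + toOp B) (toOp G')).graph := fun y =>
      mem_graph_pcomp.2 ⟨G' y, mem_graph_toOp.2 rfl, mem_graph_add_toOp.2 (by
        simpa using hgraph y)⟩
    have hle : pcomp (t + toOp B) (toOp G') ≤ toOp (T' + B ∘L G') := by
      refine LinearPMap.le_of_le_graph ?_
      rintro ⟨x, z⟩ h
      exact mem_graph_toOp.2 (LinearPMap.mem_graph_snd_inj _ (hmem x) h rfl)
    have hdense : Dense ((pcomp (t + toOp B) (toOp G')).domain : Set E) :=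
      dense_univ.mono fun x _ => LinearPMap.mem_domain_of_mem_graph (hmem x)
    obtain ⟨h1, h2⟩ := closure_eq_toOp hdense hle
    exact ⟨h1, _, h2, ⟨_, hadj⟩, hcpt2⟩

end Fredholm

/-! ### Graph projections through resolvents; gap continuity -/

section GapContinuity

open scoped WithCStarModule

set_option linter.unusedSectionVars false

variable (A : Type*) {E : Type*} [NonUnitalCStarAlgebra A] [PartialOrder A] [StarOrderedRing A]
  [NormedAddCommGroup E] [NormedSpace ℂ E] [SMul A E] [CStarModule A E]

/-- The map `E → E ⊕ E`, `x ↦ (R x, x - c R x)`, with values in the graph of `t` if `R` is the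
inverse of `t + c`. -/
noncomputable def graphParam (c : ℂ) (R : E →L[ℂ] E) : E →L[ℂ] C⋆ᵐᵒᵈ(A, E × E) :=
  ((WithCStarModule.equivL ℂ (A := A) (E := E × E)).symm : E × E →L[ℂ] C⋆ᵐᵒᵈ(A, E × E)) ∘L
    (ContinuousLinearMap.inl ℂ E E ∘L R +
      ContinuousLinearMap.inr ℂ E E ∘L (ContinuousLinearMap.id ℂ E - c • R))

/-- The map `E ⊕ E → E`, `(x, y) ↦ R x + y + c R y`. -/
noncomputable def graphCoparam (c : ℂ) (R : E →L[ℂ] E) : C⋆ᵐᵒᵈ(A, E × E) →L[ℂ] E :=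
  (R ∘L ContinuousLinearMap.fst ℂ E E +
      (ContinuousLinearMap.id ℂ E + c • R) ∘L ContinuousLinearMap.snd ℂ E E) ∘L
    (WithCStarModule.equivL ℂ (A := A) (E := E × E) : C⋆ᵐᵒᵈ(A, E × E) →L[ℂ] E × E)

variable {A}

theorem equiv_graphParam (c : ℂ) (R : E →L[ℂ] E) (x : E) :
    WithCStarModule.equiv A (E × E) (graphParam A c R x) = (R x, x - c • R x) := by
  change (R x, (0 : E)) + ((0 : E), x - c • R x) = _
  simp

theorem graphCoparam_apply (c : ℂ) (R : E →L[ℂ] E) (z : C⋆ᵐᵒᵈ(A, E × E)) :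
    graphCoparam A c R z = R z.1 + (z.2 + c • R z.2) := rfl

/-- The adjoint of the column `(R, 1 - c R)` is the row `(R⋆, 1 + c R⋆)`, because `star c = -c`. -/
theorem isAdjPair_graphParam {c : ℂ} (hc : IsImagUnit c) {R R' : E →L[ℂ] E}
    (h : IsAdjPair A R R') : IsAdjPair A (graphParam A c R) (graphCoparam A c R') := by
  intro x z
  have h1 : (graphParam A c R x).1 = R x := congrArg Prod.fst (equiv_graphParam (A := A) c R x)
  have h2 : (graphParam A c R x).2 = x - c • R x :=
    congrArg Prod.snd (equiv_graphParam (A := A) c R x)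
  rw [WithCStarModule.prod_inner, h1, h2, graphCoparam_apply]
  simp only [CStarModule.inner_sub_left, CStarModule.inner_add_right,
    CStarModule.inner_smul_left_complex, CStarModule.inner_smul_right_complex, h x _,
    hc.star_eq]
  module

/-- The orthogonal projection onto the graph, in terms of the resolvents. -/
theorem isGraphProj_of_isResolvent {t : E →ₗ.[ℂ] E} (ht : IsSymmOp A t) {c : ℂ}
    (hc : IsImagUnit c) {R R' : E →L[ℂ] E} (hR : IsResolvent t c R)
    (hR' : IsResolvent t (-c) R') :
    IsGraphProj A t (graphParam A c R ∘L graphCoparam A c R') := by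
  have hadj := isAdjPair_graphParam hc (hR.isAdjPair ht hc hR')
  have hmem : ∀ x, WithCStarModule.equiv A (E × E) (graphParam A c R x) ∈ t.graph := fun x => by
    rw [equiv_graphParam]
    exact hR.mem_graph x
  have hfix : ∀ z, WithCStarModule.equiv A (E × E) z ∈ t.graph →
      (graphParam A c R ∘L graphCoparam A c R') z = z := by
    intro z hz
    have hz1 : (z.1, z.2) ∈ t.graph := hz
    -- Multiply `R' (z.2 - c z.1) = z.1` by `c` and use `c² = -1`. Hence the coparametrization acts
    -- on the graph as `t + c`, which the parametrization inverts.
    have h1 : R' z.1 + c • R' z.2 = c • z.1 := by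
      have h2 := hR'.apply_shift _ hz1
      simp only at h2
      calc R' z.1 + c • R' z.2 = c • R' (z.2 + -c • z.1) := by
            simp only [map_add, map_smul, smul_add, smul_smul, mul_neg, hc.mul_self, neg_neg,
              one_smul, add_comm]
        _ = c • z.1 := by rw [h2]
    have h3 : graphCoparam A c R' z = z.2 + c • z.1 := by
      rw [graphCoparam_apply, ← h1]
      abel
    have h4 := hR.apply_shift _ hz1
    simp only at h4
    apply (WithCStarModule.equiv A (E × E)).injective
    rw [ContinuousLinearMap.comp_apply, equiv_graphParam, h3, h4, add_sub_cancel_right]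
    rfl
  refine ⟨?_, hadj.comp hadj.symm, ?_⟩
  · ext1 z
    exact hfix _ (hmem _)
  · ext z
    constructor
    · rintro ⟨w, rfl⟩
      exact hmem _
    · intro hz
      exact ⟨z, hfix z hz⟩

theorem IsGraphProj.graphProj_eq {t : E →ₗ.[ℂ] E} {P : C⋆ᵐᵒᵈ(A, E × E) →L[ℂ] C⋆ᵐᵒᵈ(A, E × E)}
    (hP : IsGraphProj A t P) : graphProj A t = P := by
  have h : ∃ P, IsGraphProj A t P := ⟨P, hP⟩
  rw [graphProj, dif_pos h]
  exact h.choose_spec.unique A hP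

/-- Second resolvent identity `R - R' = -R (B - B') R'`, with both resolvents of norm at most `1`.
-/
theorem IsResolvent.norm_sub_le {t : E →ₗ.[ℂ] E} {c : ℂ} {B B' R R' : E →L[ℂ] E}
    (hR : IsResolvent (t + toOp B) c R) (hR' : IsResolvent (t + toOp B') c R') :
    ‖R - R'‖ ≤ ‖B - B'‖ := by
  have h : R - R' = -(R ∘L (B - B') ∘L R') := by
    ext1 y
    have h1 := mem_graph_add_toOp.1 (hR'.mem_graph y)
    have h2 : (R' y, y - c • R' y - B' (R' y) + B (R' y)) ∈ (t + toOp B).graph :=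
      mem_graph_add_toOp.2 (by rwa [add_sub_cancel_right])
    have h3 := hR.apply_shift _ h2
    simp only at h3
    have h4 : y - c • R' y - B' (R' y) + B (R' y) + c • R' y = y + (B - B') (R' y) := by
      rw [sub_apply]
      abel
    rw [h4, map_add] at h3
    rw [sub_apply, neg_apply, eq_neg_iff_add_eq_zero, sub_add_eq_add_sub, sub_eq_zero]
    exact h3
  rw [h, norm_neg]
  calc ‖R ∘L (B - B') ∘L R'‖ ≤ ‖R‖ * (‖B - B'‖ * ‖R'‖) :=
        (ContinuousLinearMap.opNorm_comp_le _ _).trans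
          (mul_le_mul_of_nonneg_left (ContinuousLinearMap.opNorm_comp_le _ _) (norm_nonneg _))
    _ ≤ 1 * (‖B - B'‖ * 1) := by
        gcongr
        exacts [hR.norm_le, hR'.norm_le]
    _ = ‖B - B'‖ := by ring

theorem continuous_resolvent {Λ : Type*} [TopologicalSpace Λ] {t : E →ₗ.[ℂ] E} {c : ℂ}
    {B R : Λ → (E →L[ℂ] E)} (hB : Continuous B)
    (hR : ∀ l, IsResolvent (t + toOp (B l)) c (R l)) : Continuous R := by
  refine continuous_iff_continuousAt.2 fun l₀ => ?_
  refine tendsto_iff_norm_sub_tendsto_zero.2 ?_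
  exact squeeze_zero (fun _ => norm_nonneg _) (fun l => (hR l).norm_sub_le (hR l₀))
    (tendsto_iff_norm_sub_tendsto_zero.1 hB.continuousAt)

variable [CompleteSpace E]

/-- A selfadjoint regular operator depends continuously, in the gap metric, on a norm-continuous
bounded selfadjoint perturbation. -/
theorem IsSelfAdjointRegular.gapContinuous_add_toOp {Λ : Type*} [TopologicalSpace Λ]
    {t : E →ₗ.[ℂ] E} (ht : IsSelfAdjointRegular A t) {B : Λ → (E →L[ℂ] E)} (hB : Continuous B)
    (hBsa : ∀ l, IsSelfAdjointBdd A (B l)) : GapContinuous A (fun l => t + toOp (B l)) := by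
  have hex : ∀ {c : ℂ}, IsImagUnit c → ∀ l, ∃ R, IsResolvent (t + toOp (B l)) c R :=
    fun hc l => (ht.add_toOp (hBsa l)).isSymmOp.exists_isResolvent hc
      ((ht.add_toOp (hBsa l)).shiftSurjective hc)
  -- The choice is made pointwise in `l`; continuity in `l` comes afterwards from the Lipschitz
  -- bound in `B`.
  choose R hR using hex isImagUnit_I
  choose R' hR' using hex isImagUnit_I.neg
  have hP : ∀ l, IsGraphProj A (t + toOp (B l))
      (graphParam A Complex.I (R l) ∘L graphCoparam A Complex.I (R' l)) := fun l =>
    isGraphProj_of_isResolvent (ht.add_toOp (hBsa l)).isSymmOp isImagUnit_I (hR l) (hR' l)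
  have hRc : Continuous R := continuous_resolvent hB hR
  have hRc' : Continuous R' := continuous_resolvent hB hR'
  have hW : Continuous fun l => graphParam A Complex.I (R l) := by
    unfold graphParam
    fun_prop
  have hV : Continuous fun l => graphCoparam A Complex.I (R' l) := by
    unfold graphCoparam
    fun_prop
  have hc : Continuous fun l => graphProj A (t + toOp (B l)) := by
    simp only [fun l => (hP l).graphProj_eq]
    exact hW.clm_comp hV
  refine ⟨fun l => ?_, fun l₀ => ?_⟩
  · simp only [(hP l).graphProj_eq]
    exact hP l
  · have h : Filter.Tendsto (fun l => graphProj A (t + toOp (B l))) (nhds l₀)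
        (nhds (graphProj A (t + toOp (B l₀)))) := hc.continuousAt
    exact (tendsto_iff_norm_sub_tendsto_zero
      (E := C⋆ᵐᵒᵈ(A, E × E) →L[ℂ] C⋆ᵐᵒᵈ(A, E × E))).1 h

end GapContinuity

end HilbertCStar

theorem mainTheorem10 {A E Λ : Type*} [NonUnitalCStarAlgebra A] [PartialOrder A]
    [StarOrderedRing A] [NormedAddCommGroup E] [NormedSpace ℂ E] [SMul A E] [CStarModule A E]
    [CompleteSpace E] [TopologicalSpace Λ]
    (t : E →ₗ.[ℂ] E) (ht : HilbertCStar.IsSelfAdjointRegular A t)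
    (htF : HilbertCStar.IsFredholm A t)
    (B : Λ → (E →L[ℂ] E)) (hBcont : Continuous B)
    (hBsa : ∀ l, HilbertCStar.IsSelfAdjointBdd A (B l))
    (hBcpt : ∀ l, HilbertCStar.IsRelCompact A (HilbertCStar.toOp (B l)) t) :
    (∀ l, HilbertCStar.IsSelfAdjointRegular A (t + HilbertCStar.toOp (B l)) ∧
      HilbertCStar.IsFredholm A (t + HilbertCStar.toOp (B l))) ∧
    HilbertCStar.GapContinuous A (fun l => t + HilbertCStar.toOp (B l)) :=
  ⟨fun l => ⟨ht.add_toOp (hBsa l), htF.add_toOp ht (hBsa l) (hBcpt l)⟩,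
    ht.gapContinuous_add_toOp hBcont hBsa⟩
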